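/- **Theorem 3.1.** Let $\mathbb T_1,\mathbb T_2,\mathbb T_3$ be time scales (nonempty closed subsets of $\mathbb R$), let $x_0\in\mathbb T_1$, $y_0\in\mathbb T_2$, $a,b\in\mathbb T_3$ with $a\le b$, and put $X=\mathbb T_1\cap[x_0,\infty)$, $Y=\mathbb T_2\cap[y_0,\infty)$, $I=\mathbb T_3\cap[a,b]$, $H=X\times Y\times I$. (For $\mathbb T_3=\mathbb R$, $I$ is the real interval $[a,b]$ and $\Delta q=dq$.) A real function on a finite product of time scales is called rd-continuous if, at every point $p$ of the product and for every set $L$ of coordinates in which $p$ is left-dense, it has a finite limit as the argument tends to $p$ jointly, freely in the coordinates in which $p$ is right-dense and, among the other coordinates, strictly from the left in those of $L$ and held fixed in the rest. (In one variable: continuous at right-dense points, with finite left-sided limits at left-dense points.) The delta integral is the Lebesgue one, $\int_c^d \varphi\,\Delta t=\int_{[c,d)\cap\mathbb T}\varphi\,d\mu_\Delta$ for $c\le d$ in $\mathbb T$, where $\mu_\Delta$ is Lebesgue measure on $\mathbb T$ plus a point mass $\mu(t)=\sigma(t)-t$ at each right-scattered $t\in\mathbb T$, with $\sigma(t)=\inf\{s\in\mathbb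 T:s>t\}$. For $p\ge 0$ the exponential is $e_p(x,x_0)=\exp\Big(\int_{x_0}^{x}\xi_{\mu(s)}(p(s))\,\Delta s\Big)$ with $\xi_h(w)=\frac{\log(1+hw)}{h}$ for $h>0$ and $\xi_0(w)=w$. Let $g,r,f:H\to\mathbb R$ and $F:H^2\times\mathbb R\to\mathbb R$ be rd-continuous (with $\mathbb R$ regarded as a time scale in the last variable of $F$), and suppose that $$|F(x,y,z,s,t,q,v)|\le r(x,y,z)\,f(s,t,q)\,|v|\qquad\text{for all }(x,y,z),(s,t,q)\in H,\ v\in\mathbb R.$$ If $u:H\to\mathbb R$ is an rd-continuous solution of $$u(x,y,z)=g(x,y,z)+\int_{x_0}^{x}\int_{y_0}^{y}\int_a^b F\big(x,y,z,s,t,q,u(s,t,q)\big)\,\Delta q\,\Delta t\,\Delta s,\qquad (x,y,z)\in H,$$ then, for all $(x,y,z)\in H$, $$|u(x,y,z)|\le |g(x,y,z)|+r(x,y,z)\,C_2(x,y,z)\,e_{Q_2(\cdot,y,z)}(x,x_0),$$ where $$C_2(x,y,z)=\int_{x_0}^{x}\int_{y_0}^{y}\int_a^b f(s,t,q)\,|g(s,t,q)|\,\Delta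 q\,\Delta t\,\Delta s,\qquad Q_2(x,y,z)=\int_{y_0}^{y}\int_a^b f(x,t,q)\,r(x,t,q)\,\Delta q\,\Delta t .$$ -/

import Mathlib

open MeasureTheory Set Filter Topology

namespace TimeScale

/-- A time scale is a nonempty closed subset of the real line. -/
def IsTimeScale (T : Set ℝ) : Prop := T.Nonempty ∧ IsClosed T

open Classical in
/-- Forward jump operator `σ(t) = inf {s ∈ T : s > t}`, with the usual convention `σ(max T) = max T`. -/
noncomputable def forwardJump (T : Set ℝ) (t : ℝ) : ℝ :=
  if (T ∩ Ioi t).Nonempty then sInf (T ∩ Ioi t) else t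

open Classical in
/-- Backward jump operator `ρ(t) = sup {s ∈ T : s < t}`, with the usual convention `ρ(min T) = min T`. -/
noncomputable def backwardJump (T : Set ℝ) (t : ℝ) : ℝ :=
  if (T ∩ Iio t).Nonempty then sSup (T ∩ Iio t) else t

/-- Graininess `μ(t) = σ(t) - t`. -/
noncomputable def graininess (T : Set ℝ) (t : ℝ) : ℝ := forwardJump T t - t

/-- `t` is right-dense: `t < sup T` and `σ(t) = t`. -/
def RightDense (T : Set ℝ) (t : ℝ) : Prop := (T ∩ Ioi t).Nonempty ∧ forwardJump T t = t

/-- `t` is left-dense: `t > inf T` and `ρ(t) = t`. -/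
def LeftDense (T : Set ℝ) (t : ℝ) : Prop := (T ∩ Iio t).Nonempty ∧ backwardJump T t = t

open Classical in
/-- The set from which a point is approached in one coordinate: all of `T` at a right-dense point;
at any other point either `T ∩ (-∞, t)` (if `left` holds) or the point `t` alone. -/
noncomputable def approachSet (T : Set ℝ) (t : ℝ) (left : Prop) : Set ℝ :=
  if RightDense T t then T else if left then T ∩ Iio t else {t}

/-- Rd-continuity on a product `∏ i, T i` of time scales: at every point `p` of the product, and for
every set `L` of coordinates in which `p` is left-dense, `f` has a finite limit as its argument
tends to `p` jointly, freely in the coordinates where `p` is right-dense, and among the remaining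
coordinates strictly from the left in those of `L`, the others being held fixed.
When `p` itself lies in the region of approach, this limit is necessarily `f p`.
For one time scale this says: `f` is continuous at right-dense points and has a finite left-sided
limit at left-dense points. If all `T i` are `ℝ`, it is joint continuity. -/
def RdContinuous {n : ℕ} (T : Fin n → Set ℝ) (f : (Fin n → ℝ) → ℝ) : Prop :=
  ∀ p : Fin n → ℝ, (∀ i, p i ∈ T i) →
    ∀ L : Set (Fin n), (∀ i ∈ L, LeftDense (T i) (p i)) →
      ∃ l : ℝ, Tendsto f (𝓝[univ.pi fun i => approachSet (T i) (p i) (i ∈ L)] p) (𝓝 l)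

/-- The Lebesgue delta measure of `T`: Lebesgue measure on `T` plus a point mass `μ(t)` at each
right-scattered point `t`. It gives `[a, b) ∩ T` the mass `b - a` for `a ≤ b` in `T`. -/
noncomputable def deltaMeasure (T : Set ℝ) : Measure ℝ :=
  volume.restrict T +
    Measure.sum fun t : {t : ℝ // t ∈ T ∧ t < forwardJump T t} =>
      ENNReal.ofReal (graininess T t) • Measure.dirac (t : ℝ)

/-- The delta integral `∫_a^b f(t) Δt` over `T`, i.e. the integral over `[a, b) ∩ T` against the
delta measure if `a ≤ b`, and minus the integral over `[b, a) ∩ T` if `b ≤ a`. -/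
noncomputable def deltaIntegral (T : Set ℝ) (a b : ℝ) (f : ℝ → ℝ) : ℝ :=
  (∫ t in Ico a b, f t ∂(deltaMeasure T)) - ∫ t in Ico b a, f t ∂(deltaMeasure T)

open Classical in
/-- Cylinder transformation `ξ_h(z) = log(1 + h z) / h` for `h ≠ 0` and `ξ_0(z) = z`,
on the real `z` with `1 + h z > 0`. -/
noncomputable def cylinder (h z : ℝ) : ℝ := if h = 0 then z else Real.log (1 + h * z) / h

/-- The time scale exponential `e_p(t, t₀) = exp (∫_{t₀}^t ξ_{μ(s)}(p(s)) Δs)` of a positively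
regressive function `p` (that is, `1 + μ p > 0`; in particular of every `p ≥ 0`). -/
noncomputable def deltaExp (T : Set ℝ) (p : ℝ → ℝ) (t t₀ : ℝ) : ℝ :=
  Real.exp (deltaIntegral T t₀ t fun s => cylinder (graininess T s) (p s))

end TimeScale

/-!
The proof reduces the triple integral equation to a one-variable Grönwall inequality on `T₁`, and
that inequality to Lebesgue measure on the real line.

*Reduction to one variable.* The bound on `F` gives `|u| ≤ |g| + |r| W`, where `W(x, y)` is the
triple integral of `|f| |u|`. Since `W` is nondecreasing in `y`, for fixed `y` the function
`w = W(·, y)` satisfies `w(s) ≤ C₂ + ∫ Q₂ w` (`triple_gronwall`). Absolute values on `f` and `r` may be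
dropped in the conclusion because the bound on `F` makes every product `r(p) f(p')` nonnegative.

*Grönwall on a time scale* (`gronwall_deltaMeasure`). The delta measure between two points of `T` is
the image of Lebesgue measure under the map that sends a real number to the last point of `T` before
it (`map_floorIn_volume`). Hence `C + ∫ Q w Δs` extends to an absolutely continuous function `V` on
the real line, affine on each gap `(τ, σ(τ))` of `T`. Its derivative is at most `k V` with
`k(t) = Q(τ) / (1 + (t - τ) Q(τ))` on that gap, and `k = Q` on `T`. Over a gap of length `h` the
integral of `k` is `log (1 + h Q(τ))`, so `exp (∫ k)` is the time scale exponential of `Q`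
(`integral_cylinder_eq_integral_rate`), and the classical inequality `gronwall_volume` applies to `V`.

*Regularity.* An rd-continuous function on a product of time scales is Borel measurable
(`RdContinuous.measurable_indicator`) and bounded on compact sets (`RdContinuous.exists_abs_le`),
which yields the integrability of the majorants in all the iterated integrals.
-/

namespace TimeScale

/-! ### Countability of the points that are isolated on the right -/

theorem countable_isolated_right (T : Set ℝ) :
    {t | t ∈ T ∧ ∃ z, t < z ∧ ∀ s ∈ T, t < s → z ≤ s}.Countable :=
  countable_image_lt_image_Ioi_within T id

theorem le_of_lt_forwardJump {T : Set ℝ} {t s : ℝ} (hs : s ∈ T) (hts : t < s) :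
    forwardJump T t ≤ s := by
  unfold forwardJump
  rw [if_pos ⟨s, hs, hts⟩]
  exact csInf_le ⟨t, fun r hr => hr.2.le⟩ ⟨hs, hts⟩

theorem le_forwardJump (T : Set ℝ) (t : ℝ) : t ≤ forwardJump T t := by
  unfold forwardJump
  split_ifs with h
  · exact le_csInf h fun r hr => hr.2.le
  · exact le_rfl

theorem countable_rightScattered (T : Set ℝ) : {t | t ∈ T ∧ t < forwardJump T t}.Countable :=
  (countable_isolated_right T).mono <| by
    rintro t ⟨htT, ht⟩
    exact ⟨htT, forwardJump T t, ht, fun _ hs hts => le_of_lt_forwardJump hs hts⟩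

theorem countable_not_rightDense (T : Set ℝ) : {t | t ∈ T ∧ ¬ RightDense T t}.Countable := by
  refine (countable_isolated_right T).mono ?_
  rintro t ⟨htT, ht⟩
  refine ⟨htT, ?_⟩
  by_cases hne : (T ∩ Ioi t).Nonempty
  · refine ⟨forwardJump T t, lt_of_le_of_ne (le_forwardJump T t) fun h => ht ⟨hne, h.symm⟩,
      fun _ hs hts => le_of_lt_forwardJump hs hts⟩
  · exact ⟨t + 1, by linarith, fun s hs hts => absurd ⟨s, hs, hts⟩ hne⟩

instance countable_rightScattered_subtype (T : Set ℝ) :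
    Countable {t : ℝ // t ∈ T ∧ t < forwardJump T t} :=
  (countable_rightScattered T).to_subtype

/-! ### The left neighbour in a time scale -/

/-- The last point of `T` that does not exceed `s`; meaningful if `T` is closed and has a point
in `(-∞, s]`. -/
noncomputable def floorIn (T : Set ℝ) (s : ℝ) : ℝ := sSup (T ∩ Iic s)

section floorIn

variable {T : Set ℝ} {c d s t : ℝ}

theorem floorIn_mem (hT : IsClosed T) (hc : c ∈ T) (hcs : c ≤ s) : floorIn T s ∈ T ∩ Iic s :=
  (hT.inter isClosed_Iic).csSup_mem ⟨c, hc, hcs⟩ ⟨s, fun _ h => h.2⟩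

theorem le_floorIn (ht : t ∈ T) (hts : t ≤ s) : t ≤ floorIn T s :=
  le_csSup ⟨s, fun _ h => h.2⟩ ⟨ht, hts⟩

theorem floorIn_of_mem (hs : s ∈ T) : floorIn T s = s :=
  IsGreatest.csSup_eq ⟨⟨hs, self_mem_Iic⟩, fun _ h => h.2⟩

theorem floorIn_of_mem_gap (ht : t ∈ T) (hs : s ∈ Ico t (forwardJump T t)) : floorIn T s = t :=
  IsGreatest.csSup_eq ⟨⟨ht, hs.1⟩, fun r hr => by
    by_contra! h
    exact absurd (le_of_lt_forwardJump hr.1 h) (not_le.2 (lt_of_le_of_lt hr.2 hs.2))⟩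

theorem floorIn_of_mem_Icc (hT : IsClosed T) (hc : c ∈ T) (hcs : c ≤ s)
    (ht : t ∈ Icc (floorIn T s) s) : floorIn T t = floorIn T s := by
  have h := floorIn_mem hT hc hcs
  exact le_antisymm (le_floorIn (floorIn_mem hT h.1 ht.1).1 ((floorIn_mem hT h.1 ht.1).2.trans ht.2))
    (le_floorIn h.1 ht.1)

theorem lt_forwardJump_floorIn (hT : IsClosed T) (hc : c ∈ T) (hd : d ∈ T) (hs : s ∈ Ico c d)
    (hsT : s ∉ T) : floorIn T s < s ∧ s < forwardJump T (floorIn T s) := by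
  have h := floorIn_mem hT hc hs.1
  have hlt : floorIn T s < s := lt_of_le_of_ne h.2 fun h' => hsT (h' ▸ h.1)
  refine ⟨hlt, ?_⟩
  have hne : (T ∩ Ioi (floorIn T s)).Nonempty := ⟨d, hd, hlt.trans hs.2⟩
  have hmem : ∀ r ∈ T ∩ Ioi (floorIn T s), s < r := fun r hr => by
    by_contra! h'
    exact absurd (le_floorIn hr.1 h') (not_le.2 hr.2)
  have hge : sInf (T ∩ Ici s) ∈ T ∩ Ici s :=
    (hT.inter isClosed_Ici).csInf_mem ⟨d, hd, hs.2.le⟩ ⟨s, fun _ h => h.2⟩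
  have hgt : s < sInf (T ∩ Ici s) := lt_of_le_of_ne hge.2 fun h' => hsT (h' ▸ hge.1)
  unfold forwardJump
  rw [if_pos hne]
  exact hgt.trans_le (le_csInf hne fun r hr =>
    csInf_le ⟨s, fun _ h => h.2⟩ ⟨hr.1, (hmem r hr).le⟩)

theorem aemeasurable_floorIn (hT : IsClosed T) (hc : c ∈ T) (d : ℝ) :
    AEMeasurable (floorIn T) (volume.restrict (Ico c d)) :=
  aemeasurable_restrict_of_monotoneOn measurableSet_Ico fun _ hs _ _ hsr =>
    le_floorIn (floorIn_mem hT hc hs.1).1 ((floorIn_mem hT hc hs.1).2.trans hsr)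

/-- A half-open interval with endpoints in `T` splits into the points of `T` and the gaps of `T`. -/
theorem Ico_eq_union_gaps (hT : IsClosed T) (hc : c ∈ T) (hd : d ∈ T) :
    Ico c d = (T ∩ Ico c d) ∪
      ⋃ t : {t : ℝ // (t ∈ T ∧ t < forwardJump T t) ∧ t ∈ Ico c d}, Ioo (t : ℝ) (forwardJump T t) := by
  ext s
  simp only [mem_union, mem_iUnion, mem_inter_iff]
  constructor
  · intro hs
    by_cases hsT : s ∈ T
    · exact Or.inl ⟨hsT, hs⟩
    · have h := lt_forwardJump_floorIn hT hc hd hs hsT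
      exact Or.inr ⟨⟨floorIn T s, ⟨(floorIn_mem hT hc hs.1).1, h.1.trans h.2⟩,
        le_floorIn hc hs.1, h.1.trans hs.2⟩, h⟩
  · rintro (h | ⟨⟨t, ht, htI⟩, hst⟩)
    · exact h.2
    · exact ⟨htI.1.trans hst.1.le, hst.2.trans_le (le_of_lt_forwardJump hd htI.2)⟩

theorem pairwise_disjoint_gaps (T : Set ℝ) (p : ℝ → Prop) :
    Pairwise (Function.onFun Disjoint fun t : {t : ℝ // (t ∈ T ∧ t < forwardJump T t) ∧ p t} =>
      Ioo (t : ℝ) (forwardJump T t)) := by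
  intro t t' htt'
  refine Set.disjoint_left.2 fun s hs hs' => htt' (Subtype.ext ?_)
  rw [← floorIn_of_mem_gap t.2.1.1 (Ioo_subset_Ico_self hs),
    ← floorIn_of_mem_gap t'.2.1.1 (Ioo_subset_Ico_self hs')]

theorem disjoint_gaps (T A : Set ℝ) (p : ℝ → Prop) :
    Disjoint (T ∩ A) (⋃ t : {t : ℝ // (t ∈ T ∧ t < forwardJump T t) ∧ p t},
      Ioo (t : ℝ) (forwardJump T t)) := by
  refine Set.disjoint_left.2 fun s hs hs' => ?_
  obtain ⟨t, ht⟩ := mem_iUnion.1 hs'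
  exact absurd (le_of_lt_forwardJump hs.1 ht.1) (not_le.2 ht.2)

instance countable_rightScattered_subtype_and (T : Set ℝ) (p : ℝ → Prop) :
    Countable {t : ℝ // (t ∈ T ∧ t < forwardJump T t) ∧ p t} :=
  ((countable_rightScattered T).mono fun _ h => h.1 :
    {t | (t ∈ T ∧ t < forwardJump T t) ∧ p t}.Countable).to_subtype

/-! ### The delta measure as an image of Lebesgue measure -/

theorem deltaMeasure_apply (T : Set ℝ) {A : Set ℝ} (hA : MeasurableSet A) :
    deltaMeasure T A = volume (A ∩ T) +
      ∑' t : {t : ℝ // t ∈ T ∧ t < forwardJump T t},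
        ENNReal.ofReal (graininess T t) * A.indicator 1 (t : ℝ) := by
  simp only [deltaMeasure, Measure.add_apply, Measure.restrict_apply hA, Measure.sum_apply _ hA,
    Measure.smul_apply, smul_eq_mul, Measure.dirac_apply' _ hA]

/-- Between two points of `T`, the delta measure is the image of Lebesgue measure under the map
that sends every point to the last point of `T` before it: the gap `(t, σ(t))` is swept into the
atom at `t`. -/
theorem map_floorIn_volume (hT : IsClosed T) (hc : c ∈ T) (hd : d ∈ T) :
    (volume.restrict (Ico c d)).map (floorIn T) = (deltaMeasure T).restrict (Ico c d) := by
  classical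
  ext A hA
  rw [Measure.map_apply_of_aemeasurable (aemeasurable_floorIn hT hc d) hA,
    Measure.restrict_apply' measurableSet_Ico, Measure.restrict_apply hA,
    deltaMeasure_apply T (hA.inter measurableSet_Ico)]
  have hset : floorIn T ⁻¹' A ∩ Ico c d = (T ∩ (A ∩ Ico c d)) ∪
      ⋃ t : {t : ℝ // (t ∈ T ∧ t < forwardJump T t) ∧ t ∈ A ∩ Ico c d},
        Ioo (t : ℝ) (forwardJump T t) := by
    conv_lhs => rw [Ico_eq_union_gaps hT hc hd]
    ext s
    simp only [mem_inter_iff, mem_preimage, mem_union, mem_iUnion]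
    constructor
    · rintro ⟨hsA, h | ⟨t, ht⟩⟩
      · rw [floorIn_of_mem h.1] at hsA
        exact Or.inl ⟨h.1, hsA, h.2⟩
      · rw [floorIn_of_mem_gap t.2.1.1 (Ioo_subset_Ico_self ht)] at hsA
        exact Or.inr ⟨⟨t, t.2.1, hsA, t.2.2⟩, ht⟩
    · rintro (h | ⟨t, ht⟩)
      · rw [floorIn_of_mem h.1]
        exact ⟨h.2.1, Or.inl ⟨h.1, h.2.2⟩⟩
      · rw [floorIn_of_mem_gap t.2.1.1 (Ioo_subset_Ico_self ht)]
        exact ⟨t.2.2.1, Or.inr ⟨⟨t, t.2.1, t.2.2.2⟩, ht⟩⟩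
  rw [hset, measure_union (disjoint_gaps _ _ _) (MeasurableSet.iUnion fun _ => measurableSet_Ioo),
    measure_iUnion (pairwise_disjoint_gaps T _) fun _ => measurableSet_Ioo, inter_comm T]
  congr 1
  simp only [Real.volume_Ioo]
  rw [← tsum_subtype_eq_of_support_subset
    (s := {t : {t : ℝ // t ∈ T ∧ t < forwardJump T t} | (t : ℝ) ∈ A ∩ Ico c d})]
  · rw [← (Equiv.subtypeSubtypeEquivSubtypeInter
      (fun t => t ∈ T ∧ t < forwardJump T t) (fun t => t ∈ A ∩ Ico c d)).tsum_eq]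
    refine tsum_congr fun t => ?_
    rw [indicator_of_mem t.2]
    simp [graininess]
  · intro t ht
    by_contra h
    exact ht (by simp only [mem_ofPred_eq] at h; simp [indicator_of_notMem h])

theorem isFiniteMeasure_deltaMeasure (hT : IsClosed T) (hc : c ∈ T) (hd : d ∈ T) :
    IsFiniteMeasure ((deltaMeasure T).restrict (Ico c d)) := by
  rw [← map_floorIn_volume hT hc hd]
  infer_instance

theorem ae_mem_deltaMeasure (hT : IsClosed T) (c d : ℝ) :
    ∀ᵐ t ∂(deltaMeasure T).restrict (Ico c d), t ∈ T ∩ Ico c d := by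
  have h1 : ∀ᵐ t ∂deltaMeasure T, t ∈ T := by
    rw [ae_iff]
    change deltaMeasure T Tᶜ = 0
    rw [deltaMeasure_apply T hT.measurableSet.compl]
    simp only [compl_inter_self, measure_empty, zero_add, ENNReal.tsum_eq_zero]
    intro t
    simp [t.2.1]
  filter_upwards [ae_restrict_of_ae h1, ae_restrict_mem measurableSet_Ico] with t h h' using ⟨h, h'⟩

theorem integral_deltaMeasure (hT : IsClosed T) (hc : c ∈ T) (hd : d ∈ T) {φ : ℝ → ℝ}
    (hφ : Measurable φ) :
    ∫ t in Ico c d, φ t ∂deltaMeasure T = ∫ t in Ico c d, φ (floorIn T t) := by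
  rw [← map_floorIn_volume hT hc hd,
    integral_map (aemeasurable_floorIn hT hc d) hφ.aestronglyMeasurable]

end floorIn

theorem deltaIntegral_of_le (T : Set ℝ) {c d : ℝ} (h : c ≤ d) (φ : ℝ → ℝ) :
    deltaIntegral T c d φ = ∫ t in Ico c d, φ t ∂deltaMeasure T := by
  simp [deltaIntegral, Ico_eq_empty (not_lt.2 h)]

/-! ### Grönwall's inequality -/

theorem absolutelyContinuousOnInterval_lipschitzOnWith_comp {φ h : ℝ → ℝ} {c d : ℝ} {A : Set ℝ}
    {L : NNReal} (hφ : LipschitzOnWith L φ A) (hh : AbsolutelyContinuousOnInterval h c d)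
    (hA : MapsTo h (uIcc c d) A) : AbsolutelyContinuousOnInterval (fun t => φ (h t)) c d := by
  rw [absolutelyContinuousOnInterval_iff] at hh ⊢
  intro ε hε
  obtain ⟨δ, hδ, H⟩ := hh (ε / (L + 1)) (by positivity)
  refine ⟨δ, hδ, fun E hE hlt => ?_⟩
  have h1 := H E hE hlt
  rw [lt_div_iff₀ (by positivity)] at h1
  calc ∑ i ∈ Finset.range E.1, dist (φ (h (E.2 i).1)) (φ (h (E.2 i).2))
      ≤ ∑ i ∈ Finset.range E.1, L * dist (h (E.2 i).1) (h (E.2 i).2) :=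
        Finset.sum_le_sum fun i hi =>
          hφ.dist_le_mul _ (hA (hE.1 i hi).1) _ (hA (hE.1 i hi).2)
    _ = L * ∑ i ∈ Finset.range E.1, dist (h (E.2 i).1) (h (E.2 i).2) := by rw [Finset.mul_sum]
    _ ≤ (∑ i ∈ Finset.range E.1, dist (h (E.2 i).1) (h (E.2 i).2)) * (L + 1) := by
        have : 0 ≤ ∑ i ∈ Finset.range E.1, dist (h (E.2 i).1) (h (E.2 i).2) :=
          Finset.sum_nonneg fun _ _ => dist_nonneg
        nlinarith
    _ < ε := h1

theorem absolutelyContinuousOnInterval_exp {h : ℝ → ℝ} {c d : ℝ}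
    (hh : AbsolutelyContinuousOnInterval h c d) :
    AbsolutelyContinuousOnInterval (fun t => Real.exp (h t)) c d := by
  obtain ⟨C, hC⟩ := hh.exists_bound
  obtain ⟨L, hL⟩ := (Real.contDiff_exp.contDiffOn (n := 1)).exists_lipschitzOnWith (by decide)
    (convex_Icc (-C) C) isCompact_Icc
  exact absolutelyContinuousOnInterval_lipschitzOnWith_comp hL hh fun t ht => abs_le.1 (hC t ht)

/-- Grönwall's inequality for an absolutely continuous function `C + ∫ p` and an integrable rate
`k`. The product with `exp (-∫ k)` is absolutely continuous with nonpositive derivative. -/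
theorem gronwall_volume {c d C : ℝ} (hcd : c ≤ d) {p k : ℝ → ℝ}
    (hp : IntervalIntegrable p volume c d) (hk : IntervalIntegrable k volume c d)
    (h : ∀ t ∈ Ioo c d, p t ≤ k t * (C + ∫ s in c..t, p s)) :
    C + ∫ s in c..d, p s ≤ C * Real.exp (∫ s in c..d, k s) := by
  have hV : AbsolutelyContinuousOnInterval (fun t => ∫ s in c..t, p s) c d :=
    hp.absolutelyContinuousOnInterval_intervalIntegral left_mem_uIcc
  have hV' : AbsolutelyContinuousOnInterval (fun t => C + ∫ s in c..t, p s) c d := by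
    have hc : AbsolutelyContinuousOnInterval (fun _ : ℝ => C) c d :=
      (LipschitzWith.const C).lipschitzOnWith.absolutelyContinuousOnInterval
    exact hc.fun_add hV
  have hK : AbsolutelyContinuousOnInterval (fun t => ∫ s in c..t, k s) c d :=
    hk.absolutelyContinuousOnInterval_intervalIntegral left_mem_uIcc
  have hE := absolutelyContinuousOnInterval_exp hK.fun_neg
  have key := (hV'.fun_mul hE).integral_deriv_eq_sub
  have hle : ∫ t in c..d, deriv (fun t => (C + ∫ s in c..t, p s) *
      Real.exp (-∫ s in c..t, k s)) t ≤ 0 := by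
    rw [intervalIntegral.integral_of_le hcd, integral_Ioc_eq_integral_Ioo]
    refine integral_nonpos_of_ae ?_
    filter_upwards [ae_restrict_of_ae hp.ae_hasDerivAt_integral,
      ae_restrict_of_ae hk.ae_hasDerivAt_integral, ae_restrict_mem measurableSet_Ioo]
      with t h1 h2 ht
    have ht' : t ∈ uIcc c d := by rw [uIcc_of_le hcd]; exact Ioo_subset_Icc_self ht
    have d1 := (h1 ht' c left_mem_uIcc).const_add C
    have d2 := (h2 ht' c left_mem_uIcc).fun_neg.exp
    refine (d1.fun_mul d2).deriv.trans_le ?_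
    simp only [Pi.zero_apply]
    have hpos := Real.exp_pos (-∫ s in c..t, k s)
    have := h t ht
    nlinarith
  rw [key] at hle
  simp only [intervalIntegral.integral_same, neg_zero, Real.exp_zero, add_zero, mul_one] at hle
  rw [Real.exp_neg, sub_nonpos, ← div_eq_mul_inv, div_le_iff₀ (Real.exp_pos _)] at hle
  exact hle

/-- On a gap `(t, s)`, an affine function with relative initial slope `q` has logarithmic
derivative `q / (1 + (x - t) q)`. -/
theorem integral_gap_rate {t s q : ℝ} (hts : t < s) (hq : 0 ≤ q) :
    ∫ x in t..s, q / (1 + (x - t) * q) = (s - t) * cylinder (s - t) q := by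
  have hne : s - t ≠ 0 := (sub_pos.2 hts).ne'
  have hpos : ∀ x ∈ uIcc t s, 0 < 1 + (x - t) * q := fun x hx => by
    rw [uIcc_of_le hts.le] at hx
    have := mul_nonneg (sub_nonneg.2 hx.1) hq
    linarith
  rw [intervalIntegral.integral_eq_sub_of_hasDerivAt
    (f := fun x => Real.log (1 + (x - t) * q))]
  · simp only [sub_self, zero_mul, add_zero, Real.log_one, sub_zero, cylinder, if_neg hne]
    field_simp
  · intro x hx
    have := ((((hasDerivAt_id x).sub_const t).mul_const q).const_add 1).log (hpos x hx).ne'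
    simpa using this
  · refine ContinuousOn.intervalIntegrable ?_
    exact continuousOn_const.div (by fun_prop) fun x hx => (hpos x hx).ne'

theorem cylinder_nonneg {h q : ℝ} (hh : 0 ≤ h) (hq : 0 ≤ q) : 0 ≤ cylinder h q := by
  unfold cylinder
  split_ifs
  · exact hq
  · exact div_nonneg (Real.log_nonneg (by nlinarith [mul_nonneg hh hq])) hh

theorem cylinder_le {h q : ℝ} (hh : 0 ≤ h) (hq : 0 ≤ q) : cylinder h q ≤ q := by
  unfold cylinder
  split_ifs with h0
  · exact le_rfl
  · have hpos : 0 < h := lt_of_le_of_ne hh (Ne.symm h0)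
    rw [div_le_iff₀ hpos]
    have := Real.log_le_sub_one_of_pos (show 0 < 1 + h * q by nlinarith [mul_nonneg hh hq])
    linarith

theorem monotone_forwardJump (T : Set ℝ) : Monotone (forwardJump T) := by
  intro t s hts
  by_cases hs : (T ∩ Ioi s).Nonempty
  · have h : forwardJump T s = sInf (T ∩ Ioi s) := if_pos hs
    rw [h]
    exact le_csInf hs fun r hr => le_of_lt_forwardJump hr.1 (hts.trans_lt hr.2)
  · by_cases ht : (T ∩ Ioi t).Nonempty
    · obtain ⟨r, hrT, hr⟩ := ht
      exact (le_of_lt_forwardJump hrT hr).trans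
        ((not_lt.1 fun h => hs ⟨r, hrT, h⟩).trans (le_forwardJump T s))
    · have h : forwardJump T t = t := if_neg ht
      rw [h]
      exact hts.trans (le_forwardJump T s)

theorem measurable_graininess (T : Set ℝ) : Measurable (graininess T) :=
  (monotone_forwardJump T).measurable.sub measurable_id

theorem graininess_nonneg (T : Set ℝ) (t : ℝ) : 0 ≤ graininess T t :=
  sub_nonneg.2 (le_forwardJump T t)

theorem measurable_cylinder_graininess (T : Set ℝ) {Q : ℝ → ℝ} (hQ : Measurable Q) :
    Measurable fun t => cylinder (graininess T t) (Q t) := by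
  have hg := measurable_graininess T
  exact Measurable.ite (measurableSet_eq_fun hg measurable_const) hQ
    ((Real.measurable_log.comp ((hg.mul hQ).const_add 1)).div hg)

/-- The exponent of the time scale exponential is an integral over the real line of the
logarithmic growth rate of a function that is affine on every gap of `T`. -/
theorem integral_cylinder_eq_integral_rate {T : Set ℝ} (hT : IsClosed T) {c d M : ℝ}
    (hc : c ∈ T) (hd : d ∈ T) {Q : ℝ → ℝ} (hQ : Measurable Q) (hQ0 : ∀ t, 0 ≤ Q t)
    (hQM : ∀ t, Q t ≤ M) :
    IntegrableOn (fun t => Q (floorIn T t) / (1 + (t - floorIn T t) * Q (floorIn T t)))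
      (Ico c d) ∧
    ∫ t in Ico c d, Q (floorIn T t) / (1 + (t - floorIn T t) * Q (floorIn T t)) =
      ∫ t in Ico c d, cylinder (graininess T t) (Q t) ∂deltaMeasure T := by
  have hτ := aemeasurable_floorIn hT hc d
  have hξm := measurable_cylinder_graininess T hQ
  have hk : IntegrableOn (fun t => Q (floorIn T t) / (1 + (t - floorIn T t) * Q (floorIn T t)))
      (Ico c d) := by
    refine Integrable.of_bound (C := M) ?_ ?_
    · have hQτ := hQ.comp_aemeasurable hτ
      exact (hQτ.div (((aemeasurable_id.sub hτ).mul hQτ).const_add 1)).aestronglyMeasurable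
    · filter_upwards [ae_restrict_mem measurableSet_Ico] with t ht
      have h1 : 0 ≤ t - floorIn T t := sub_nonneg.2 (floorIn_mem hT hc ht.1).2
      have h2 := mul_nonneg h1 (hQ0 (floorIn T t))
      rw [Real.norm_of_nonneg (div_nonneg (hQ0 _) (by linarith))]
      exact (div_le_self (hQ0 _) (by linarith)).trans (hQM _)
  have hξ : IntegrableOn (fun t => cylinder (graininess T (floorIn T t)) (Q (floorIn T t)))
      (Ico c d) := by
    refine Integrable.of_bound (C := M) (hξm.comp_aemeasurable hτ).aestronglyMeasurable ?_
    filter_upwards with t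
    rw [Real.norm_of_nonneg (cylinder_nonneg (graininess_nonneg _ _) (hQ0 _))]
    exact (cylinder_le (graininess_nonneg _ _) (hQ0 _)).trans (hQM _)
  refine ⟨hk, ?_⟩
  rw [integral_deltaMeasure hT hc hd hξm]
  rw [Ico_eq_union_gaps hT hc hd] at hk hξ ⊢
  have hU : MeasurableSet (⋃ t : {t : ℝ // (t ∈ T ∧ t < forwardJump T t) ∧ t ∈ Ico c d},
      Ioo (t : ℝ) (forwardJump T t)) := MeasurableSet.iUnion fun _ => measurableSet_Ioo
  rw [setIntegral_union (disjoint_gaps _ _ _) hU hk.left_of_union hk.right_of_union,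
    setIntegral_union (disjoint_gaps _ _ _) hU hξ.left_of_union hξ.right_of_union,
    integral_iUnion (fun _ => measurableSet_Ioo) (pairwise_disjoint_gaps T _) hk.right_of_union,
    integral_iUnion (fun _ => measurableSet_Ioo) (pairwise_disjoint_gaps T _) hξ.right_of_union]
  congr 1
  · refine setIntegral_congr_ae (hT.measurableSet.inter measurableSet_Ico) ?_
    -- The graininess vanishes on `T` outside the countable set of right-scattered points.
    filter_upwards [(countable_rightScattered T).ae_notMem volume] with t ht htT
    have hg : graininess T t = 0 := by
      by_contra hne
      exact ht ⟨htT.1, sub_pos.1 (lt_of_le_of_ne (graininess_nonneg T t) (Ne.symm hne))⟩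
    rw [floorIn_of_mem htT.1, hg]
    simp [cylinder]
  · refine tsum_congr fun t => ?_
    have hlt := t.2.1.2
    have hfl : ∀ s ∈ Ioo (t : ℝ) (forwardJump T t), floorIn T s = t := fun s hs =>
      floorIn_of_mem_gap t.2.1.1 (Ioo_subset_Ico_self hs)
    have e1 := setIntegral_congr_fun (μ := volume) (s := Ioo (t : ℝ) (forwardJump T t))
      measurableSet_Ioo
      (f := fun s => Q (floorIn T s) / (1 + (s - floorIn T s) * Q (floorIn T s)))
      (g := fun s => Q t / (1 + (s - t) * Q t)) fun s hs => by simp only [hfl s hs]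
    have e2 := setIntegral_congr_fun (μ := volume) (s := Ioo (t : ℝ) (forwardJump T t))
      measurableSet_Ioo
      (f := fun s => cylinder (graininess T (floorIn T s)) (Q (floorIn T s)))
      (g := fun _ => cylinder (graininess T t) (Q t)) fun s hs => by simp only [hfl s hs]
    rw [e1, e2, ← integral_Ioc_eq_integral_Ioo, ← intervalIntegral.integral_of_le hlt.le,
      integral_gap_rate hlt (hQ0 t), setIntegral_const]
    simp [graininess, hlt.le]

/-- Grönwall's inequality on a time scale. The function `C + ∫_c^t Q w Δs` is extended to the real
line by affine interpolation over the gaps, where its logarithmic growth rate is at most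
`Q / (1 + (t - τ) Q)`, with `τ` the left end of the gap. -/
theorem gronwall_deltaMeasure {T : Set ℝ} (hT : IsClosed T) {c d M C : ℝ} (hc : c ∈ T) (hd : d ∈ T)
    (hcd : c ≤ d) {Q w : ℝ → ℝ} (hQ : Measurable Q) (hw : Measurable w) (hQ0 : ∀ t, 0 ≤ Q t)
    (hQM : ∀ t, Q t ≤ M) (hwM : ∀ t, |w t| ≤ M)
    (h : ∀ t ∈ T ∩ Ico c d, w t ≤ C + ∫ s in Ico c t, Q s * w s ∂deltaMeasure T) :
    C + ∫ s in Ico c d, Q s * w s ∂deltaMeasure T ≤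
      C * Real.exp (∫ s in Ico c d, cylinder (graininess T s) (Q s) ∂deltaMeasure T) := by
  have hτ := aemeasurable_floorIn hT hc d
  obtain ⟨hk, hkξ⟩ := integral_cylinder_eq_integral_rate hT hc hd hQ hQ0 hQM
  have hQw : Measurable fun t => Q t * w t := hQ.mul hw
  have hp : IntegrableOn (fun t => Q (floorIn T t) * w (floorIn T t)) (Ico c d) := by
    refine Integrable.of_bound (C := M * M) (hQw.comp_aemeasurable hτ).aestronglyMeasurable ?_
    filter_upwards with t
    rw [norm_mul, Real.norm_of_nonneg (hQ0 _)]
    exact mul_le_mul (hQM _) (hwM _) (abs_nonneg _) ((hQ0 0).trans (hQM 0))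
  have hvol : ∀ {φ : ℝ → ℝ} {t : ℝ}, c ≤ t → ∫ s in c..t, φ s = ∫ s in Ico c t, φ s :=
    fun {φ t} ht => by
      rw [intervalIntegral.integral_of_le ht, integral_Ico_eq_integral_Ioc]
  have hp' : IntervalIntegrable (fun t => Q (floorIn T t) * w (floorIn T t)) volume c d :=
    (intervalIntegrable_iff_integrableOn_Ico_of_le hcd).2 hp
  rw [← hkξ, integral_deltaMeasure hT hc hd hQw, ← hvol hcd, ← hvol hcd]
  refine gronwall_volume hcd hp' ((intervalIntegrable_iff_integrableOn_Ico_of_le hcd).2 hk) ?_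
  intro t ht
  obtain ⟨hτT, hτt⟩ := floorIn_mem hT hc ht.1.le
  have hcτ : c ≤ floorIn T t := le_floorIn hc ht.1.le
  have hτt' : floorIn T t ≤ t := hτt
  have h1 := h _ ⟨hτT, hcτ, hτt'.trans_lt ht.2⟩
  rw [integral_deltaMeasure hT hc hτT hQw, ← hvol hcτ] at h1
  have hsplit : ∫ s in c..t, Q (floorIn T s) * w (floorIn T s) =
      (∫ s in c..floorIn T t, Q (floorIn T s) * w (floorIn T s)) +
        (t - floorIn T t) * (Q (floorIn T t) * w (floorIn T t)) := by
    rw [← intervalIntegral.integral_add_adjacent_intervals (b := floorIn T t)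
      (hp'.mono_set (by rw [uIcc_of_le hcτ, uIcc_of_le hcd]
                        exact Icc_subset_Icc le_rfl (hτt'.trans ht.2.le)))
      (hp'.mono_set (by rw [uIcc_of_le hτt', uIcc_of_le hcd]
                        exact Icc_subset_Icc hcτ ht.2.le))]
    congr 1
    rw [intervalIntegral.integral_congr (g := fun _ => Q (floorIn T t) * w (floorIn T t)),
      intervalIntegral.integral_const, smul_eq_mul]
    intro s hs
    rw [uIcc_of_le hτt'] at hs
    simp only [floorIn_of_mem_Icc hT hc ht.1.le hs]
  rw [hsplit]
  have hq := hQ0 (floorIn T t)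
  have hpos : 0 < 1 + (t - floorIn T t) * Q (floorIn T t) := by
    have := mul_nonneg (sub_nonneg.2 hτt') hq
    linarith
  rw [div_mul_eq_mul_div, le_div_iff₀ hpos]
  nlinarith [mul_le_mul_of_nonneg_left h1 hq]

/-! ### Rd-continuous functions are Borel measurable and locally bounded -/

theorem measurable_indicator_of_countable_cover {α ι : Type*} [TopologicalSpace α]
    [MeasurableSpace α] [BorelSpace α] [Countable ι] {φ : α → ℝ} {A : ι → Set α}
    (hA : ∀ i, MeasurableSet (A i)) (hφ : ∀ i, ContinuousOn φ (A i)) :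
    Measurable ((⋃ i, A i).indicator φ) := by
  refine measurable_of_restrict_of_restrict_compl (MeasurableSet.iUnion hA) ?_ ?_
  · refine measurable_of_isOpen fun U hU => ?_
    have hset : MeasurableSet (⋃ i, A i ∩ φ ⁻¹' U) := MeasurableSet.iUnion fun i => by
      obtain ⟨V, hV, hVU⟩ := continuousOn_iff'.1 (hφ i) U hU
      rw [inter_comm, hVU]
      exact hV.measurableSet.inter (hA i)
    convert measurable_subtype_coe hset using 1
    ext ⟨p, hp⟩
    simp only [mem_preimage, domRestrict_apply, indicator_of_mem hp, mem_iUnion, mem_inter_iff]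
    constructor
    · intro h
      obtain ⟨i, hi⟩ := mem_iUnion.1 hp
      exact ⟨i, hi, h⟩
    · rintro ⟨i, -, h⟩
      exact h
  · have : (⋃ i, A i)ᶜ.domRestrict ((⋃ i, A i).indicator φ) = fun _ => 0 := by
      ext p
      exact indicator_of_notMem p.2 φ
    rw [this]
    exact measurable_const

/-- Split the product according to which coordinates fail to be right-dense and to their values
there. These are countably many pieces, and on each of them the function is continuous. -/
theorem RdContinuous.measurable_indicator {n : ℕ} {T : Fin n → Set ℝ} {φ : (Fin n → ℝ) → ℝ}
    (hφ : RdContinuous T φ) (hT : ∀ i, IsClosed (T i)) :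
    Measurable ((univ.pi T).indicator φ) := by
  let N : Fin n → Set ℝ := fun i => {t | t ∈ T i ∧ ¬ RightDense (T i) t}
  have hN : ∀ i, (N i).Countable := fun i => countable_not_rightDense (T i)
  have : ∀ i, Countable (N i) := fun i => (hN i).to_subtype
  let piece : (i : Fin n) → Option (N i) → Set ℝ := fun i o => o.elim (T i \ N i) fun t => {(t : ℝ)}
  have hcover : univ.pi T = ⋃ c : (i : Fin n) → Option (N i), univ.pi fun i => piece i (c i) := by
    ext p
    simp only [mem_iUnion, Set.mem_pi, mem_univ, true_imp_iff]
    constructor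
    · intro hp
      have : ∀ i, ∃ o : Option (N i), p i ∈ piece i o := fun i => by
        by_cases hi : p i ∈ N i
        · exact ⟨some ⟨p i, hi⟩, rfl⟩
        · exact ⟨none, hp i, hi⟩
      choose c hc using this
      exact ⟨c, hc⟩
    · rintro ⟨c, hc⟩ i
      have h := hc i
      rcases hci : c i with _ | t
      · rw [hci] at h
        exact h.1
      · rw [hci] at h
        have ht : p i = t := h
        exact ht ▸ t.2.1
  rw [hcover]
  refine measurable_indicator_of_countable_cover (fun c => MeasurableSet.univ_pi fun i => ?_)
    fun c p hp => ?_
  · rcases c i with _ | t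
    · exact (hT i).measurableSet.diff (hN i).measurableSet
    · exact measurableSet_singleton _
  · have hpT : ∀ i, p i ∈ T i := by
      have : p ∈ univ.pi T := hcover ▸ mem_iUnion.2 ⟨c, hp⟩
      exact fun i => this i (mem_univ i)
    obtain ⟨l, hl⟩ := hφ p hpT ∅ fun i hi => absurd hi (notMem_empty i)
    have hsub : (univ.pi fun i => piece i (c i)) ⊆
        univ.pi fun i => approachSet (T i) (p i) (i ∈ (∅ : Set (Fin n))) := by
      intro r hr i _
      have hri := hr i (mem_univ i)
      have hpi := hp i (mem_univ i)
      change r i ∈ approachSet (T i) (p i) (i ∈ (∅ : Set (Fin n)))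
      unfold approachSet
      rcases hci : c i with _ | t
      · simp only [hci] at hri hpi
        rw [if_pos (not_not.1 fun h => hpi.2 ⟨hpi.1, h⟩)]
        exact hri.1
      · simp only [hci] at hri hpi
        have h1 : r i = t := hri
        have h2 : p i = t := hpi
        rw [if_neg (h2 ▸ t.2.2), if_neg (notMem_empty i)]
        exact h1.trans h2.symm
    have hl' := hl.mono_left (nhdsWithin_mono p hsub)
    have hlp : l = φ p :=
      tendsto_nhds_unique (hl'.mono_left (pure_le_nhdsWithin hp)) (tendsto_pure_nhds φ p)
    rw [hlp] at hl'
    exact hl'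

/-- Near a point that is not right-dense, a time scale lies weakly to the left of that point, and
it has no points strictly to the left unless the point is left-dense. -/
theorem eventually_eq_or_lt_leftDense {T : Set ℝ} (t : ℝ)
    (hr : ¬ RightDense T t) :
    ∀ᶠ s in 𝓝 t, s ∈ T → s = t ∨ (s < t ∧ LeftDense T t) := by
  have h1 : ∀ᶠ s in 𝓝 t, s ∈ T → s ≤ t := by
    by_cases hne : (T ∩ Ioi t).Nonempty
    · have hlt : t < forwardJump T t :=
        lt_of_le_of_ne (le_forwardJump T t) fun h => hr ⟨hne, h.symm⟩
      filter_upwards [Iio_mem_nhds hlt] with s hs hsT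
      by_contra! h
      exact absurd (le_of_lt_forwardJump hsT h) (not_le.2 hs)
    · exact Eventually.of_forall fun s hsT => not_lt.1 fun h => hne ⟨s, hsT, h⟩
  have h2 : ∀ᶠ s in 𝓝 t, s ∈ T → t ≤ s ∨ LeftDense T t := by
    by_cases hl : LeftDense T t
    · exact Eventually.of_forall fun _ _ => Or.inr hl
    · by_cases hne : (T ∩ Iio t).Nonempty
      · have hb : backwardJump T t = sSup (T ∩ Iio t) := if_pos hne
        have hle : sSup (T ∩ Iio t) ≤ t := csSup_le hne fun r hr => hr.2.le
        have hlt : sSup (T ∩ Iio t) < t := lt_of_le_of_ne hle fun h => hl ⟨hne, hb.trans h⟩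
        filter_upwards [Ioi_mem_nhds hlt] with s hs hsT
        refine Or.inl (not_lt.1 fun h => ?_)
        exact absurd (le_csSup ⟨t, fun r hr => hr.2.le⟩ (show s ∈ T ∩ Iio t from ⟨hsT, h⟩))
          (not_le.2 hs)
      · exact Eventually.of_forall fun s hsT => Or.inl (not_lt.1 fun h => hne ⟨s, hsT, h⟩)
  filter_upwards [h1, h2] with s hs1 hs2 hsT
  rcases (hs1 hsT).lt_or_eq with h | h
  · exact Or.inr ⟨h, (hs2 hsT).resolve_left (not_le.2 h)⟩
  · exact Or.inl h

/-- A neighbourhood of a point of the product is covered by the finitely many regions of approach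
in the definition of rd-continuity, along each of which the function converges. -/
theorem RdContinuous.eventually_abs_le {n : ℕ} {T : Fin n → Set ℝ} {φ : (Fin n → ℝ) → ℝ}
    (hφ : RdContinuous T φ) {p : Fin n → ℝ} (hp : p ∈ univ.pi T) :
    ∃ C, ∀ᶠ r in 𝓝[univ.pi T] p, |φ r| ≤ C := by
  have hL : ∀ L : Set (Fin n), ∃ C, (∀ i ∈ L, LeftDense (T i) (p i)) →
      ∀ᶠ r in 𝓝[univ.pi fun i => approachSet (T i) (p i) (i ∈ L)] p, |φ r| ≤ C := fun L => by
    by_cases h : ∀ i ∈ L, LeftDense (T i) (p i)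
    · obtain ⟨l, hl⟩ := hφ p (fun i => hp i (mem_univ i)) L h
      exact ⟨|l| + 1, fun _ => hl.abs.eventually (Iic_mem_nhds (lt_add_one _))⟩
    · exact ⟨0, fun h' => absurd h' h⟩
  choose C hC using hL
  obtain ⟨B, hB⟩ := (finite_range C).bddAbove
  refine ⟨B, ?_⟩
  have hcoord : ∀ᶠ r in 𝓝 p, ∀ i, ¬ RightDense (T i) (p i) → r i ∈ T i →
      r i = p i ∨ (r i < p i ∧ LeftDense (T i) (p i)) := by
    refine eventually_all.2 fun i => ?_
    by_cases hr : RightDense (T i) (p i)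
    · exact Eventually.of_forall fun _ h => absurd hr h
    · filter_upwards [(continuous_apply i).continuousAt.eventually
        (eventually_eq_or_lt_leftDense (p i) hr)] with r hr' _
      exact hr'
  have hall : ∀ᶠ r in 𝓝 p, ∀ L : Set (Fin n), (∀ i ∈ L, LeftDense (T i) (p i)) →
      r ∈ (univ.pi fun i => approachSet (T i) (p i) (i ∈ L)) → |φ r| ≤ C L := by
    refine eventually_all.2 fun L => ?_
    by_cases h : ∀ i ∈ L, LeftDense (T i) (p i)
    · filter_upwards [eventually_nhdsWithin_iff.1 (hC L h)] with r hr _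
      exact hr
    · exact Eventually.of_forall fun _ h' => absurd h' h
  rw [eventually_nhdsWithin_iff]
  filter_upwards [hcoord, hall] with r h1 h2 hrT
  let L : Set (Fin n) := {i | ¬ RightDense (T i) (p i) ∧ r i < p i}
  have hrT' : ∀ i, r i ∈ T i := fun i => hrT i (mem_univ i)
  refine (h2 L ?_ ?_).trans (hB (mem_range_self L))
  · rintro i ⟨hi, hlt⟩
    rcases h1 i hi (hrT' i) with h | h
    · exact absurd h hlt.ne
    · exact h.2
  · intro i _
    change r i ∈ approachSet (T i) (p i) (i ∈ L)
    unfold approachSet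
    split_ifs with ha hb
    · exact hrT' i
    · exact ⟨hrT' i, hb.2⟩
    · rcases h1 i ha (hrT' i) with h | h
      · exact h
      · exact absurd ⟨ha, h.1⟩ hb

theorem RdContinuous.exists_abs_le {n : ℕ} {T : Fin n → Set ℝ} {φ : (Fin n → ℝ) → ℝ}
    (hφ : RdContinuous T φ) {K : Set (Fin n → ℝ)} (hK : IsCompact K)
    (hKT : K ⊆ univ.pi T) : ∃ C, ∀ p ∈ K, |φ p| ≤ C := by
  refine hK.induction_on (p := fun S => ∃ C, ∀ p ∈ S, |φ p| ≤ C) ⟨0, by simp⟩ ?_ ?_ ?_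
  · rintro s t hst ⟨C, hC⟩
    exact ⟨C, fun p hp => hC p (hst hp)⟩
  · rintro s t ⟨C, hC⟩ ⟨D, hD⟩
    refine ⟨max C D, fun p hp => ?_⟩
    rcases hp with hp | hp
    · exact (hC p hp).trans (le_max_left _ _)
    · exact (hD p hp).trans (le_max_right _ _)
  · intro p hp
    obtain ⟨C, hC⟩ := hφ.eventually_abs_le (hKT hp)
    exact ⟨{r | |φ r| ≤ C}, nhdsWithin_mono p hKT hC, C, fun r hr => hr⟩

/-- On a compact box, the absolute value of an rd-continuous function of three variables agrees
with a bounded Borel function on the whole space. -/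
theorem RdContinuous.exists_measurable_extension {X Y I : Set ℝ} {φ : ℝ → ℝ → ℝ → ℝ}
    (hφ : RdContinuous ![X, Y, I] fun p => φ (p 0) (p 1) (p 2)) (hX : IsClosed X)
    (hY : IsClosed Y) (hI : IsCompact I) {x y : ℝ} (hXx : IsCompact (X ∩ Iic x))
    (hYy : IsCompact (Y ∩ Iic y)) :
    ∃ ψ : ℝ → ℝ → ℝ → ℝ, (Measurable fun p : ℝ × ℝ × ℝ => ψ p.1 p.2.1 p.2.2) ∧
      (∀ s t q, 0 ≤ ψ s t q) ∧ (∃ M, ∀ s t q, ψ s t q ≤ M) ∧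
      ∀ s ∈ X ∩ Iic x, ∀ t ∈ Y ∩ Iic y, ∀ q ∈ I, ψ s t q = |φ s t q| := by
  classical
  have hT : ∀ i, IsClosed ((![X, Y, I] : Fin 3 → Set ℝ) i) := by
    intro i
    fin_cases i
    · exact hX
    · exact hY
    · exact hI.isClosed
  have hKc : ∀ i, IsCompact ((![X ∩ Iic x, Y ∩ Iic y, I] : Fin 3 → Set ℝ) i) := by
    intro i
    fin_cases i
    · exact hXx
    · exact hYy
    · exact hI
  have hsub : univ.pi ![X ∩ Iic x, Y ∩ Iic y, I] ⊆ univ.pi ![X, Y, I] := by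
    refine pi_mono fun i _ => ?_
    fin_cases i
    · exact inter_subset_left
    · exact inter_subset_left
    · exact subset_rfl
  obtain ⟨M, hM⟩ := hφ.exists_abs_le (isCompact_univ_pi hKc) hsub
  have hmeas := (hφ.measurable_indicator hT).indicator (isCompact_univ_pi hKc).measurableSet
  have hmap : Measurable fun p : ℝ × ℝ × ℝ => (![p.1, p.2.1, p.2.2] : Fin 3 → ℝ) := by
    refine measurable_pi_lambda _ fun i => ?_
    fin_cases i
    · exact measurable_fst
    · exact measurable_fst.comp measurable_snd
    · exact measurable_snd.comp measurable_snd
  refine ⟨fun s t q => |(univ.pi ![X ∩ Iic x, Y ∩ Iic y, I]).indicator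
    ((univ.pi ![X, Y, I]).indicator fun p => φ (p 0) (p 1) (p 2)) ![s, t, q]|,
    (hmeas.comp hmap).abs, fun _ _ _ => abs_nonneg _, ⟨max M 0, fun s t q => ?_⟩, ?_⟩
  · beta_reduce
    by_cases h : ![s, t, q] ∈ univ.pi ![X ∩ Iic x, Y ∩ Iic y, I]
    · rw [indicator_of_mem h, indicator_of_mem (hsub h)]
      exact (hM _ h).trans (le_max_left _ _)
    · rw [indicator_of_notMem h, abs_zero]
      exact le_max_right _ _
  · intro s hs t ht q hq
    have h : ![s, t, q] ∈ univ.pi ![X ∩ Iic x, Y ∩ Iic y, I] := by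
      intro i _
      fin_cases i
      · exact hs
      · exact ht
      · exact hq
    simp only [indicator_of_mem h, indicator_of_mem (hsub h)]
    rfl

/-! ### Iterated integrals of bounded functions -/

theorem integral_integral_nonneg {ν₂ ν₃ : Measure ℝ} {ψ : ℝ → ℝ → ℝ → ℝ}
    (h0 : ∀ s t q, 0 ≤ ψ s t q) (s : ℝ) : 0 ≤ ∫ t, ∫ q, ψ s t q ∂ν₃ ∂ν₂ :=
  integral_nonneg fun t => integral_nonneg (h0 s t)

section iterated

variable {ν₁ ν₂ ν₃ : Measure ℝ} [IsFiniteMeasure ν₁] [IsFiniteMeasure ν₂] [IsFiniteMeasure ν₃]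
  {ψ : ℝ → ℝ → ℝ → ℝ} {M : ℝ}

theorem integrable_section (hψ : Measurable fun p : ℝ × ℝ × ℝ => ψ p.1 p.2.1 p.2.2)
    (h0 : ∀ s t q, 0 ≤ ψ s t q) (hM : ∀ s t q, ψ s t q ≤ M) (s t : ℝ) :
    Integrable (fun q => ψ s t q) ν₃ := by
  refine Integrable.of_bound (C := M) ?_ (Eventually.of_forall fun q => ?_)
  · have hm : Measurable fun q : ℝ => ((s, t, q) : ℝ × ℝ × ℝ) := by fun_prop
    exact (hψ.comp hm).aestronglyMeasurable
  · rw [Real.norm_of_nonneg (h0 s t q)]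
    exact hM s t q

theorem measurable_integral_last (hψ : Measurable fun p : ℝ × ℝ × ℝ => ψ p.1 p.2.1 p.2.2) :
    Measurable fun p : ℝ × ℝ => ∫ q, ψ p.1 p.2 q ∂ν₃ := by
  have hm : Measurable fun p : (ℝ × ℝ) × ℝ => ((p.1.1, p.1.2, p.2) : ℝ × ℝ × ℝ) := by fun_prop
  exact (StronglyMeasurable.integral_prod_right' (ν := ν₃)
    (hψ.comp hm).stronglyMeasurable).measurable

theorem integral_last_le (h0 : ∀ s t q, 0 ≤ ψ s t q) (hM : ∀ s t q, ψ s t q ≤ M) (s t : ℝ) :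
    ∫ q, ψ s t q ∂ν₃ ≤ M * ν₃.real univ := by
  refine (Real.le_norm_self _).trans (norm_integral_le_of_norm_le_const (Eventually.of_forall fun q => ?_))
  rw [Real.norm_of_nonneg (h0 s t q)]
  exact hM s t q

theorem integrable_integral_last (hψ : Measurable fun p : ℝ × ℝ × ℝ => ψ p.1 p.2.1 p.2.2)
    (h0 : ∀ s t q, 0 ≤ ψ s t q) (hM : ∀ s t q, ψ s t q ≤ M) (s : ℝ) :
    Integrable (fun t => ∫ q, ψ s t q ∂ν₃) ν₂ := by
  refine Integrable.of_bound (C := M * ν₃.real univ) ?_ (Eventually.of_forall fun t => ?_)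
  · exact ((measurable_integral_last hψ).comp measurable_prodMk_left).aestronglyMeasurable
  · rw [Real.norm_of_nonneg (integral_nonneg (h0 s t))]
    exact integral_last_le h0 hM s t

theorem measurable_integral_integral (hψ : Measurable fun p : ℝ × ℝ × ℝ => ψ p.1 p.2.1 p.2.2) :
    Measurable fun s => ∫ t, ∫ q, ψ s t q ∂ν₃ ∂ν₂ :=
  (StronglyMeasurable.integral_prod_right' (ν := ν₂)
    (measurable_integral_last (ν₃ := ν₃) hψ).stronglyMeasurable).measurable

theorem integral_integral_le (h0 : ∀ s t q, 0 ≤ ψ s t q) (hM : ∀ s t q, ψ s t q ≤ M) (s : ℝ) :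
    ∫ t, ∫ q, ψ s t q ∂ν₃ ∂ν₂ ≤ M * ν₃.real univ * ν₂.real univ := by
  refine (Real.le_norm_self _).trans (norm_integral_le_of_norm_le_const (Eventually.of_forall fun t => ?_))
  rw [Real.norm_of_nonneg (integral_nonneg (h0 s t))]
  exact integral_last_le h0 hM s t

theorem integrable_integral_integral (hψ : Measurable fun p : ℝ × ℝ × ℝ => ψ p.1 p.2.1 p.2.2)
    (h0 : ∀ s t q, 0 ≤ ψ s t q) (hM : ∀ s t q, ψ s t q ≤ M) :
    Integrable (fun s => ∫ t, ∫ q, ψ s t q ∂ν₃ ∂ν₂) ν₁ := by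
  refine Integrable.of_bound (C := M * ν₃.real univ * ν₂.real univ)
    (measurable_integral_integral hψ).aestronglyMeasurable (Eventually.of_forall fun s => ?_)
  rw [Real.norm_of_nonneg (integral_integral_nonneg h0 s)]
  exact integral_integral_le h0 hM s

/-- Only the dominating function has to be measurable: where `Φ` fails to be integrable, its
integral is `0`. -/
theorem abs_integral_integral_integral_le {Φ : ℝ → ℝ → ℝ → ℝ} {R : ℝ}
    (hψ : Measurable fun p : ℝ × ℝ × ℝ => ψ p.1 p.2.1 p.2.2)
    (h0 : ∀ s t q, 0 ≤ ψ s t q) (hM : ∀ s t q, ψ s t q ≤ M)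
    (h : ∀ᵐ s ∂ν₁, ∀ᵐ t ∂ν₂, ∀ᵐ q ∂ν₃, |Φ s t q| ≤ R * ψ s t q) :
    |∫ s, ∫ t, ∫ q, Φ s t q ∂ν₃ ∂ν₂ ∂ν₁| ≤ R * ∫ s, ∫ t, ∫ q, ψ s t q ∂ν₃ ∂ν₂ ∂ν₁ := by
  rw [← integral_const_mul, ← Real.norm_eq_abs]
  have i1 : Integrable (fun s => ∫ t, ∫ q, ψ s t q ∂ν₃ ∂ν₂) ν₁ :=
    integrable_integral_integral hψ h0 hM
  refine norm_integral_le_of_norm_le (i1.const_mul R) ?_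
  filter_upwards [h] with s hs
  rw [← integral_const_mul]
  have i2 : Integrable (fun t => ∫ q, ψ s t q ∂ν₃) ν₂ := integrable_integral_last hψ h0 hM s
  refine norm_integral_le_of_norm_le (i2.const_mul R) ?_
  filter_upwards [hs] with t ht
  rw [← integral_const_mul]
  exact norm_integral_le_of_norm_le ((integrable_section hψ h0 hM s t).const_mul R) ht

end iterated

/-! ### The three-variable Grönwall estimate -/

/-- The integral inequality for nonnegative bounded Borel functions. Since the triple integral `W`
of `φ υ` is nondecreasing in its second upper limit, `W(·, y)` satisfies a one-variable
Grönwall inequality with rate `∫∫ φ ρ`. -/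
theorem triple_gronwall {T₁ T₂ T₃ : Set ℝ} (hT₁ : IsClosed T₁) (hT₂ : IsClosed T₂)
    (hT₃ : IsClosed T₃) {x₀ x y₀ y a b M : ℝ} (hx₀ : x₀ ∈ T₁) (hx : x ∈ T₁) (hx₀x : x₀ ≤ x)
    (hy₀ : y₀ ∈ T₂) (hy : y ∈ T₂) (ha : a ∈ T₃) (hb : b ∈ T₃) {φ ρ γ υ : ℝ → ℝ → ℝ → ℝ}
    (hφ : Measurable fun p : ℝ × ℝ × ℝ => φ p.1 p.2.1 p.2.2)
    (hρ : Measurable fun p : ℝ × ℝ × ℝ => ρ p.1 p.2.1 p.2.2)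
    (hγ : Measurable fun p : ℝ × ℝ × ℝ => γ p.1 p.2.1 p.2.2)
    (hυ : Measurable fun p : ℝ × ℝ × ℝ => υ p.1 p.2.1 p.2.2)
    (hφ0 : ∀ s t q, 0 ≤ φ s t q) (hρ0 : ∀ s t q, 0 ≤ ρ s t q) (hγ0 : ∀ s t q, 0 ≤ γ s t q)
    (hυ0 : ∀ s t q, 0 ≤ υ s t q) (hφM : ∀ s t q, φ s t q ≤ M) (hρM : ∀ s t q, ρ s t q ≤ M)
    (hγM : ∀ s t q, γ s t q ≤ M) (hυM : ∀ s t q, υ s t q ≤ M)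
    (h : ∀ s ∈ T₁ ∩ Ico x₀ x, ∀ t ∈ T₂ ∩ Ico y₀ y, ∀ q ∈ T₃ ∩ Ico a b,
      υ s t q ≤ γ s t q + ρ s t q * ∫ s' in Ico x₀ s, ∫ t' in Ico y₀ t, ∫ q' in Ico a b,
        φ s' t' q' * υ s' t' q' ∂deltaMeasure T₃ ∂deltaMeasure T₂ ∂deltaMeasure T₁) :
    ∫ s in Ico x₀ x, ∫ t in Ico y₀ y, ∫ q in Ico a b,
        φ s t q * υ s t q ∂deltaMeasure T₃ ∂deltaMeasure T₂ ∂deltaMeasure T₁ ≤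
      (∫ s in Ico x₀ x, ∫ t in Ico y₀ y, ∫ q in Ico a b,
        φ s t q * γ s t q ∂deltaMeasure T₃ ∂deltaMeasure T₂ ∂deltaMeasure T₁) *
      Real.exp (∫ s in Ico x₀ x, cylinder (graininess T₁ s)
        (∫ t in Ico y₀ y, ∫ q in Ico a b, φ s t q * ρ s t q ∂deltaMeasure T₃ ∂deltaMeasure T₂)
          ∂deltaMeasure T₁) := by
  have := isFiniteMeasure_deltaMeasure hT₁ hx₀ hx
  have := isFiniteMeasure_deltaMeasure hT₂ hy₀ hy
  have := isFiniteMeasure_deltaMeasure hT₃ ha hb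
  have hM0 : 0 ≤ M := (hφ0 0 0 0).trans (hφM 0 0 0)
  have hφυ := hφ.mul hυ
  have hφγ := hφ.mul hγ
  have hφρ := hφ.mul hρ
  have hφυ0 := fun s t q => mul_nonneg (hφ0 s t q) (hυ0 s t q)
  have hφγ0 := fun s t q => mul_nonneg (hφ0 s t q) (hγ0 s t q)
  have hφρ0 := fun s t q => mul_nonneg (hφ0 s t q) (hρ0 s t q)
  have hφυM := fun s t q => mul_le_mul (hφM s t q) (hυM s t q) (hυ0 s t q) hM0
  have hφγM := fun s t q => mul_le_mul (hφM s t q) (hγM s t q) (hγ0 s t q) hM0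
  have hφρM := fun s t q => mul_le_mul (hφM s t q) (hρM s t q) (hρ0 s t q) hM0
  set ν₂ := (deltaMeasure T₂).restrict (Ico y₀ y)
  set ν₃ := (deltaMeasure T₃).restrict (Ico a b)
  let G : ℝ → ℝ := fun s => ∫ t, ∫ q, φ s t q * υ s t q ∂ν₃ ∂ν₂
  let A : ℝ → ℝ := fun s => ∫ t, ∫ q, φ s t q * γ s t q ∂ν₃ ∂ν₂
  let Q : ℝ → ℝ := fun s => ∫ t, ∫ q, φ s t q * ρ s t q ∂ν₃ ∂ν₂
  have hG0 : ∀ s, 0 ≤ G s := integral_integral_nonneg hφυ0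
  have hA0 : ∀ s, 0 ≤ A s := integral_integral_nonneg hφγ0
  have hQ0 : ∀ s, 0 ≤ Q s := integral_integral_nonneg hφρ0
  have hG : IntegrableOn G (Ico x₀ x) (deltaMeasure T₁) :=
    integrable_integral_integral hφυ hφυ0 hφυM
  have hA : IntegrableOn A (Ico x₀ x) (deltaMeasure T₁) :=
    integrable_integral_integral hφγ hφγ0 hφγM
  have hQm : Measurable Q := measurable_integral_integral hφρ
  have hQM : ∀ s, Q s ≤ M * M * ν₃.real univ * ν₂.real univ := integral_integral_le hφρ0 hφρM
  -- The upper limit is cut off at `x`, so that `w` is monotone and bounded on the whole line.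
  let w : ℝ → ℝ := fun s => ∫ r in Ico x₀ (min s x), G r ∂deltaMeasure T₁
  have hsubx : ∀ s, Ico x₀ (min s x) ⊆ Ico x₀ x := fun s => Ico_subset_Ico le_rfl (min_le_right s x)
  have hw_mono : Monotone w := fun s s' hss' =>
    setIntegral_mono_set (hG.mono_set (hsubx s')) (Eventually.of_forall hG0)
      (Ico_subset_Ico le_rfl (min_le_min_right x hss')).eventuallyLE
  have hw0 : ∀ s, 0 ≤ w s := fun s => integral_nonneg hG0
  have hwM : ∀ s, w s ≤ w x := fun s => by
    refine setIntegral_mono_set (hG.mono_set (hsubx x)) (Eventually.of_forall hG0) ?_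
    rw [min_self]
    exact (hsubx s).eventuallyLE
  have hw_eq : ∀ s ≤ x, w s = ∫ r in Ico x₀ s, G r ∂deltaMeasure T₁ := fun s hs => by
    simp only [w, min_eq_left hs]
  have hGle : ∀ s ∈ T₁ ∩ Ico x₀ x, G s ≤ A s + Q s * w s := by
    intro s hs
    have hin : ∀ t ∈ T₂ ∩ Ico y₀ y, ∀ q ∈ T₃ ∩ Ico a b,
        φ s t q * υ s t q ≤ φ s t q * γ s t q + φ s t q * ρ s t q * w s := by
      intro t ht q hq
      have hW : ∫ s' in Ico x₀ s, ∫ t' in Ico y₀ t, ∫ q',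
          φ s' t' q' * υ s' t' q' ∂ν₃ ∂deltaMeasure T₂ ∂deltaMeasure T₁ ≤ w s := by
        rw [hw_eq s hs.2.2.le]
        refine integral_mono_of_nonneg (Eventually.of_forall fun s' =>
          integral_integral_nonneg hφυ0 s') (hG.mono_set (Ico_subset_Ico le_rfl hs.2.2.le))
          (Eventually.of_forall fun s' => ?_)
        exact setIntegral_mono_set (integrable_integral_last hφυ hφυ0 hφυM s')
          (Eventually.of_forall fun t' => integral_nonneg (hφυ0 s' t'))
          (Ico_subset_Ico le_rfl ht.2.2.le).eventuallyLE
      have h1 := (h s hs t ht q hq).trans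
        (add_le_add_right (mul_le_mul_of_nonneg_left hW (hρ0 s t q)) _)
      have h2 := mul_le_mul_of_nonneg_left h1 (hφ0 s t q)
      linarith
    have hmid : ∀ t ∈ T₂ ∩ Ico y₀ y, ∫ q, φ s t q * υ s t q ∂ν₃ ≤
        (∫ q, φ s t q * γ s t q ∂ν₃) + (∫ q, φ s t q * ρ s t q ∂ν₃) * w s := by
      intro t ht
      rw [← integral_mul_const, ← integral_add (integrable_section hφγ hφγ0 hφγM s t)
        ((integrable_section hφρ hφρ0 hφρM s t).mul_const _)]
      refine integral_mono_ae (integrable_section hφυ hφυ0 hφυM s t)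
        ((integrable_section hφγ hφγ0 hφγM s t).add
          ((integrable_section hφρ hφρ0 hφρM s t).mul_const _)) ?_
      filter_upwards [ae_mem_deltaMeasure hT₃ a b] with q hq using hin t ht q hq
    simp only [G, A, Q]
    rw [← integral_mul_const, ← integral_add (integrable_integral_last hφγ hφγ0 hφγM s)
      ((integrable_integral_last hφρ hφρ0 hφρM s).mul_const _)]
    refine integral_mono_ae (integrable_integral_last hφυ hφυ0 hφυM s)
      ((integrable_integral_last hφγ hφγ0 hφγM s).add
        ((integrable_integral_last hφρ hφρ0 hφρM s).mul_const _)) ?_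
    filter_upwards [ae_mem_deltaMeasure hT₂ y₀ y] with t ht using hmid t ht
  have hQw : IntegrableOn (fun s => Q s * w s) (Ico x₀ x) (deltaMeasure T₁) := by
    refine Integrable.of_bound (C := M * M * ν₃.real univ * ν₂.real univ * w x)
      (hQm.mul hw_mono.measurable).aestronglyMeasurable (Eventually.of_forall fun s => ?_)
    rw [Real.norm_of_nonneg (mul_nonneg (hQ0 s) (hw0 s))]
    exact mul_le_mul (hQM s) (hwM s) (hw0 s) ((hQ0 s).trans (hQM s))
  have hwle : ∀ s ≤ x, w s ≤ (∫ r in Ico x₀ x, A r ∂deltaMeasure T₁) +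
      ∫ r in Ico x₀ s, Q r * w r ∂deltaMeasure T₁ := by
    intro s hs
    have hsub : Ico x₀ s ⊆ Ico x₀ x := Ico_subset_Ico le_rfl hs
    rw [hw_eq s hs]
    calc ∫ r in Ico x₀ s, G r ∂deltaMeasure T₁
        ≤ ∫ r in Ico x₀ s, (A r + Q r * w r) ∂deltaMeasure T₁ := by
          refine integral_mono_ae (hG.mono_set hsub)
            ((hA.mono_set hsub).add (hQw.mono_set hsub)) ?_
          filter_upwards [ae_mem_deltaMeasure hT₁ x₀ s] with r hr using hGle r ⟨hr.1, hsub hr.2⟩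
      _ = (∫ r in Ico x₀ s, A r ∂deltaMeasure T₁) +
            ∫ r in Ico x₀ s, Q r * w r ∂deltaMeasure T₁ :=
          integral_add (hA.mono_set hsub) (hQw.mono_set hsub)
      _ ≤ _ := by
          gcongr
          exact Eventually.of_forall hA0
  have key := gronwall_deltaMeasure hT₁ (M := max (M * M * ν₃.real univ * ν₂.real univ) (w x))
    hx₀ hx hx₀x hQm hw_mono.measurable hQ0 (fun s => (hQM s).trans (le_max_left _ _))
    (fun s => (abs_of_nonneg (hw0 s)).trans_le ((hwM s).trans (le_max_right _ _)))
    (fun s hs => hwle s hs.2.2.le)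
  have hfin := (hwle x le_rfl).trans key
  rw [hw_eq x le_rfl] at hfin
  exact hfin

theorem deltaIntegral_eq_setIntegral {T : Set ℝ} (hT : IsClosed T) {c d : ℝ} (hcd : c ≤ d)
    {φ ψ : ℝ → ℝ} (h : ∀ t ∈ T ∩ Ico c d, φ t = ψ t) :
    deltaIntegral T c d φ = ∫ t in Ico c d, ψ t ∂deltaMeasure T := by
  rw [deltaIntegral_of_le T hcd]
  refine integral_congr_ae ?_
  filter_upwards [ae_mem_deltaMeasure hT c d] with t ht using h t ht

end TimeScale

/-! ### The estimate for the integral equation -/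

open TimeScale in
theorem theorem3p1
    (T₁ T₂ T₃ : Set ℝ) (hT₁ : IsTimeScale T₁) (hT₂ : IsTimeScale T₂) (hT₃ : IsTimeScale T₃)
    (x₀ y₀ a b : ℝ) (hx₀ : x₀ ∈ T₁) (hy₀ : y₀ ∈ T₂) (ha : a ∈ T₃) (hb : b ∈ T₃) (hab : a ≤ b)
    (X Y I : Set ℝ) (hX : X = T₁ ∩ Ici x₀) (hY : Y = T₂ ∩ Ici y₀) (hI : I = T₃ ∩ Icc a b)
    (g r f u : ℝ → ℝ → ℝ → ℝ) (F : ℝ → ℝ → ℝ → ℝ → ℝ → ℝ → ℝ → ℝ)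
    (hg : RdContinuous ![X, Y, I] fun p => g (p 0) (p 1) (p 2))
    (hr : RdContinuous ![X, Y, I] fun p => r (p 0) (p 1) (p 2))
    (hf : RdContinuous ![X, Y, I] fun p => f (p 0) (p 1) (p 2))
    (hF : RdContinuous ![X, Y, I, X, Y, I, univ]
      fun p => F (p 0) (p 1) (p 2) (p 3) (p 4) (p 5) (p 6))
    (hFbound : ∀ x ∈ X, ∀ y ∈ Y, ∀ z ∈ I, ∀ s ∈ X, ∀ t ∈ Y, ∀ q ∈ I, ∀ v : ℝ,
      |F x y z s t q v| ≤ r x y z * f s t q * |v|)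
    (hu : RdContinuous ![X, Y, I] fun p => u (p 0) (p 1) (p 2))
    (hsol : ∀ x ∈ X, ∀ y ∈ Y, ∀ z ∈ I,
      u x y z = g x y z +
        deltaIntegral T₁ x₀ x fun s => deltaIntegral T₂ y₀ y fun t => deltaIntegral T₃ a b fun q =>
          F x y z s t q (u s t q))
    (C₂ Q₂ : ℝ → ℝ → ℝ → ℝ)
    (hC₂ : ∀ x y z, C₂ x y z =
      deltaIntegral T₁ x₀ x fun s => deltaIntegral T₂ y₀ y fun t => deltaIntegral T₃ a b fun q =>
        f s t q * |g s t q|)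
    (hQ₂ : ∀ x y z, Q₂ x y z =
      deltaIntegral T₂ y₀ y fun t => deltaIntegral T₃ a b fun q => f x t q * r x t q) :
    ∀ x ∈ X, ∀ y ∈ Y, ∀ z ∈ I,
      |u x y z| ≤ |g x y z| +
        r x y z * C₂ x y z * deltaExp T₁ (fun s => Q₂ s y z) x x₀ := by
  have hc₁ := hT₁.2
  have hc₂ := hT₂.2
  have hc₃ := hT₃.2
  subst hX hY hI
  intro x hx y hy z hz
  have hcX : IsCompact (T₁ ∩ Ici x₀ ∩ Iic x) := by
    rw [inter_assoc, Ici_inter_Iic]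
    exact isCompact_Icc.inter_left hc₁
  have hcY : IsCompact (T₂ ∩ Ici y₀ ∩ Iic y) := by
    rw [inter_assoc, Ici_inter_Iic]
    exact isCompact_Icc.inter_left hc₂
  have hcI : IsCompact (T₃ ∩ Icc a b) := isCompact_Icc.inter_left hc₃
  have hXc := hc₁.inter (isClosed_Ici (a := x₀))
  have hYc := hc₂.inter (isClosed_Ici (a := y₀))
  obtain ⟨φ, hφ, hφ0, ⟨Mφ, hφM⟩, hφf⟩ := hf.exists_measurable_extension hXc hYc hcI hcX hcY
  obtain ⟨ρ, hρ, hρ0, ⟨Mρ, hρM⟩, hρr⟩ := hr.exists_measurable_extension hXc hYc hcI hcX hcY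
  obtain ⟨γ, hγ, hγ0, ⟨Mγ, hγM⟩, hγg⟩ := hg.exists_measurable_extension hXc hYc hcI hcX hcY
  obtain ⟨υ, hυ, hυ0, ⟨Mυ, hυM⟩, hυu⟩ := hu.exists_measurable_extension hXc hYc hcI hcX hcY
  obtain ⟨M, hM⟩ : ∃ M, Mφ ≤ M ∧ Mρ ≤ M ∧ Mγ ≤ M ∧ Mυ ≤ M :=
    ⟨max (max Mφ Mρ) (max Mγ Mυ), by simp⟩
  have hM0 : 0 ≤ M := ((hφ0 0 0 0).trans (hφM 0 0 0)).trans hM.1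
  -- The bound on `F` makes all these products nonnegative.
  have hrf : ∀ s ∈ T₁ ∩ Ici x₀, ∀ t ∈ T₂ ∩ Ici y₀, ∀ q ∈ T₃ ∩ Icc a b, ∀ s' ∈ T₁ ∩ Ici x₀,
      ∀ t' ∈ T₂ ∩ Ici y₀, ∀ q' ∈ T₃ ∩ Icc a b,
      r s t q * f s' t' q' = |r s t q| * |f s' t' q'| := by
    intro s hs t ht q hq s' hs' t' ht' q' hq'
    have h1 := (abs_nonneg _).trans (hFbound s hs t ht q hq s' hs' t' ht' q' hq' 1)
    rw [abs_one, mul_one] at h1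
    rw [← abs_mul, abs_of_nonneg h1]
  have hIcoI : ∀ q ∈ T₃ ∩ Ico a b, q ∈ T₃ ∩ Icc a b := fun q hq =>
    ⟨hq.1, Ico_subset_Icc_self hq.2⟩
  have hIcoX : ∀ {s s' : ℝ}, s ≤ x → s' ∈ T₁ ∩ Ico x₀ s → s' ∈ T₁ ∩ Ici x₀ ∩ Iic x :=
    fun hs hs' => ⟨⟨hs'.1, hs'.2.1⟩, hs'.2.2.le.trans hs⟩
  have hIcoY : ∀ {t t' : ℝ}, t ≤ y → t' ∈ T₂ ∩ Ico y₀ t → t' ∈ T₂ ∩ Ici y₀ ∩ Iic y :=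
    fun ht ht' => ⟨⟨ht'.1, ht'.2.1⟩, ht'.2.2.le.trans ht⟩
  have hφυM : ∀ s t q, φ s t q * υ s t q ≤ M * M := fun s t q =>
    mul_le_mul ((hφM s t q).trans hM.1) ((hυM s t q).trans hM.2.2.2) (hυ0 s t q) hM0
  have hub : ∀ s ∈ T₁ ∩ Ici x₀ ∩ Iic x, ∀ t ∈ T₂ ∩ Ici y₀ ∩ Iic y, ∀ q ∈ T₃ ∩ Icc a b,
      υ s t q ≤ γ s t q + ρ s t q * ∫ s' in Ico x₀ s, ∫ t' in Ico y₀ t, ∫ q' in Ico a b,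
        φ s' t' q' * υ s' t' q' ∂deltaMeasure T₃ ∂deltaMeasure T₂ ∂deltaMeasure T₁ := by
    intro s hs t ht q hq
    have := isFiniteMeasure_deltaMeasure hc₁ hx₀ hs.1.1
    have := isFiniteMeasure_deltaMeasure hc₂ hy₀ ht.1.1
    have := isFiniteMeasure_deltaMeasure hc₃ ha hb
    rw [hυu s hs t ht q hq, hγg s hs t ht q hq, hρr s hs t ht q hq, hsol s hs.1 t ht.1 q hq]
    refine (abs_add_le _ _).trans (add_le_add_right ?_ _)
    simp only [deltaIntegral_of_le T₁ hs.1.2, deltaIntegral_of_le T₂ ht.1.2,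
      deltaIntegral_of_le T₃ hab]
    refine abs_integral_integral_integral_le (hφ.mul hυ)
      (fun s' t' q' => mul_nonneg (hφ0 s' t' q') (hυ0 s' t' q')) hφυM ?_
    filter_upwards [ae_mem_deltaMeasure hc₁ x₀ s] with s' hs'
    filter_upwards [ae_mem_deltaMeasure hc₂ y₀ t] with t' ht'
    filter_upwards [ae_mem_deltaMeasure hc₃ a b] with q' hq'
    have hs'' := hIcoX hs.2 hs'
    have ht'' := hIcoY ht.2 ht'
    have hq'' := hIcoI q' hq'
    rw [hφf s' hs'' t' ht'' q' hq'', hυu s' hs'' t' ht'' q' hq'', ← mul_assoc,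
      ← hrf s hs.1 t ht.1 q hq s' hs''.1 t' ht''.1 q' hq'']
    exact hFbound s hs.1 t ht.1 q hq s' hs''.1 t' ht''.1 q' hq'' _
  have hgr := triple_gronwall hc₁ hc₂ hc₃ hx₀ hx.1 hx.2 hy₀ hy.1 ha hb hφ hρ hγ hυ
    hφ0 hρ0 hγ0 hυ0 (fun s t q => (hφM s t q).trans hM.1) (fun s t q => (hρM s t q).trans hM.2.1)
    (fun s t q => (hγM s t q).trans hM.2.2.1) (fun s t q => (hυM s t q).trans hM.2.2.2)
    (fun s hs t ht q hq => hub s (hIcoX le_rfl hs) t (hIcoY le_rfl ht) q (hIcoI q hq))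
  have hxx : x ∈ T₁ ∩ Ici x₀ ∩ Iic x := ⟨hx, self_mem_Iic⟩
  have hyy : y ∈ T₂ ∩ Ici y₀ ∩ Iic y := ⟨hy, self_mem_Iic⟩
  have hC : r x y z * C₂ x y z = |r x y z| * ∫ s in Ico x₀ x, ∫ t in Ico y₀ y, ∫ q in Ico a b,
      φ s t q * γ s t q ∂deltaMeasure T₃ ∂deltaMeasure T₂ ∂deltaMeasure T₁ := by
    rw [hC₂]
    simp only [deltaIntegral_of_le T₁ hx.2, deltaIntegral_of_le T₂ hy.2,
      deltaIntegral_of_le T₃ hab, ← integral_const_mul]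
    refine integral_congr_ae ?_
    filter_upwards [ae_mem_deltaMeasure hc₁ x₀ x] with s hs
    refine integral_congr_ae ?_
    filter_upwards [ae_mem_deltaMeasure hc₂ y₀ y] with t ht
    refine integral_congr_ae ?_
    filter_upwards [ae_mem_deltaMeasure hc₃ a b] with q hq
    have hs' := hIcoX le_rfl hs
    have ht' := hIcoY le_rfl ht
    have hq' := hIcoI q hq
    rw [hφf s hs' t ht' q hq', hγg s hs' t ht' q hq', ← mul_assoc, ← mul_assoc,
      hrf x hx y hy z hz s hs'.1 t ht'.1 q hq']
  have hE : deltaExp T₁ (fun s => Q₂ s y z) x x₀ = Real.exp (∫ s in Ico x₀ x,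
      cylinder (graininess T₁ s) (∫ t in Ico y₀ y, ∫ q in Ico a b,
        φ s t q * ρ s t q ∂deltaMeasure T₃ ∂deltaMeasure T₂) ∂deltaMeasure T₁) := by
    rw [deltaExp, deltaIntegral_eq_setIntegral hc₁ hx.2]
    intro s hs
    congr 1
    rw [hQ₂]
    refine deltaIntegral_eq_setIntegral hc₂ hy.2 fun t ht =>
      deltaIntegral_eq_setIntegral hc₃ hab fun q hq => ?_
    have hs' := hIcoX le_rfl hs
    have ht' := hIcoY le_rfl ht
    have hq' := hIcoI q hq
    rw [hφf s hs' t ht' q hq', hρr s hs' t ht' q hq', mul_comm,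
      hrf s hs'.1 t ht'.1 q hq' s hs'.1 t ht'.1 q hq', mul_comm]
  have hxyz := hub x hxx y hyy z hz
  rw [hυu x hxx y hyy z hz, hγg x hxx y hyy z hz, hρr x hxx y hyy z hz] at hxyz
  rw [hC, hE, mul_assoc]
  exact hxyz.trans (add_le_add_right (mul_le_mul_of_nonneg_left hgr (abs_nonneg _)) _)
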